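/- **Theorem (Reduction to a one-parameter family).** Let $n\ge 0$ and let $p\in\mathbb R[x,y]$ be a nonzero polynomial of degree at most $n$ in each variable. Call $p$ *real stable* if $p(z_1,z_2)\neq 0$ for all $z_1,z_2\in\mathbb C$ with $\operatorname{Im} z_1>0$ and $\operatorname{Im} z_2>0$. Call a univariate real polynomial *real-rooted* if it is identically zero or all of its complex roots are real. Let $m$ be the total degree of $p$ and let $p_H(x,y,z)=z^{m}\,p(x/z,y/z)\in\mathbb R[x,y,z]$ be the homogenization of $p$. Then $p$ is real stable if and only if the following two conditions hold: 1. for every $\gamma\in\mathbb R$ the univariate polynomial $q_\gamma(t)=p(\gamma+t,t)\in\mathbb R[t]$ is real-rooted; 2. up to replacing $p$ by $-p$, the univariate polynomial $t\mapsto p_H(t,1-t,0)$ is strictly positive on the interval $(0,1)$; that is, it is either strictly positive on all of $(0,1)$ or strictly negative on all of $(0,1)$. -/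

import Mathlib

/-- A real univariate polynomial is real-rooted if it is zero or all its complex roots are real. -/
def RealRooted (f : Polynomial ℝ) : Prop :=
  f = 0 ∨ ∀ z : ℂ, Polynomial.aeval z f = 0 → z.im = 0

/-- A real polynomial is real stable if it is zero or has no zero all of whose coordinates
lie in the open upper half-plane. -/
def RealStable {σ : Type*} (p : MvPolynomial σ ℝ) : Prop :=
  p = 0 ∨ ∀ z : σ → ℂ, (∀ i, 0 < (z i).im) → MvPolynomial.aeval z p ≠ 0

/-- The univariate polynomial `q_γ(t) = p(γ + t, t)`. -/
noncomputable def diagRestriction (p : MvPolynomial (Fin 2) ℝ) (γ : ℝ) : Polynomial ℝ :=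
  MvPolynomial.aeval ![Polynomial.C γ + Polynomial.X, Polynomial.X] p

/-- The homogenization `p_H(x, y, z) = z ^ m * p(x / z, y / z)` of a bivariate polynomial, where
`m` is the total degree of `p`; the subtraction does not truncate, since `d 0 + d 1 ≤ m` for
every exponent `d` in the support of `p`. -/
noncomputable def homogenization (p : MvPolynomial (Fin 2) ℝ) : MvPolynomial (Fin 3) ℝ :=
  ∑ d ∈ p.support, MvPolynomial.C (p.coeff d) * MvPolynomial.X 0 ^ d 0 * MvPolynomial.X 1 ^ d 1 *
    MvPolynomial.X 2 ^ (p.totalDegree - (d 0 + d 1))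

/-- The explicit sum agrees with the formula `z ^ m * p(x / z, y / z)`. -/
theorem eval_homogenization (p : MvPolynomial (Fin 2) ℝ) (x y z : ℝ) (hz : z ≠ 0) :
    MvPolynomial.eval ![x, y, z] (homogenization p) =
      z ^ p.totalDegree * MvPolynomial.eval ![x / z, y / z] p := by
  rw [MvPolynomial.eval_eq' _ p, homogenization, map_sum, Finset.mul_sum]
  refine Finset.sum_congr rfl fun d hd => ?_
  have h : d 0 + d 1 ≤ p.totalDegree := by
    have := MvPolynomial.le_totalDegree hd
    rwa [Finsupp.sum_fintype _ _ (fun _ => rfl), Fin.sum_univ_two] at this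
  obtain ⟨k, hk⟩ := Nat.exists_eq_add_of_le h
  rw [hk]
  simp [Fin.prod_univ_two, div_pow, pow_add]
  field_simp

/-!
Let `L` be the top-degree form of `p` and fix a direction `e > 0`.

If `p` is stable, its restrictions to real lines of direction `e` have no zeros in the upper half
plane, hence by complex conjugation only real ones. Moreover `L v ≠ 0` for `v > 0`: choose a real
`c` with `L c ≠ 0`. The polynomials `w ↦ τ ^ m * p((i v + w c) / τ)` have the nonzero leading
coefficient `L c` and become `w ↦ L (i v + w c)` at `τ = 0`. If `L v = 0`, the root `w = 0` at
`τ = 0` therefore persists near `0` for small `τ > 0`, where it gives a zero of `p` whose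
coordinates have imaginary parts close to `v / τ > 0`.

Conversely, fix a real point `x` and `α > 0`. As `v` ranges over the positive orthant, which is
connected, the polynomials `w ↦ p(x + i α e + w v)` have constant degree because `L v ≠ 0`, and
they have no real root because a real `w` gives a nonreal point of a real line of direction `e`.
Hence no root can cross the real axis, and for `v = e` there is none above it. Any point with
positive imaginary parts `y` has the form `x + i α e + w v` with `w = i` and `v = y - α e`.
-/

section RootFamilies

open Polynomial Topology

theorem norm_leadingCoeff_mul_pow_le_norm_eval {K : Type*} [NormedField K] {q : K[X]}
    (hq : q.Splits) {z : K} {δ : ℝ} (hδ : 0 ≤ δ) (hroot : ∀ w, q.IsRoot w → δ ≤ ‖z - w‖) :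
    ‖q.leadingCoeff‖ * δ ^ q.natDegree ≤ ‖q.eval z‖ := by
  have hprod : δ ^ q.natDegree ≤ (q.roots.map fun w => ‖z - w‖).prod := by
    have := Multiset.prod_map_le_prod_map₀ (s := q.roots) (fun _ => δ) (fun w => ‖z - w‖)
      (fun _ _ => hδ) fun w hw => hroot w (isRoot_of_mem_roots hw)
    rwa [Multiset.map_const', Multiset.prod_replicate, ← hq.natDegree_eq_card_roots] at this
  have hnorm : ‖(q.roots.map (z - ·)).prod‖ = (q.roots.map fun w => ‖z - w‖).prod :=
    (q.roots.prod_hom' (normHom : K →*₀ ℝ) (z - ·)).symm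
  rw [hq.eval_eq_prod_roots, norm_mul, hnorm]
  gcongr

variable {X K : Type*} [TopologicalSpace X] [NormedField K] {q : X → K[X]} {m : ℕ}
  (hcoeff : ∀ k, Continuous fun x => (q x).coeff k) (hdeg : ∀ x, (q x).degree = m)

include hcoeff hdeg

theorem continuous_eval_of_continuous_coeff :
    Continuous fun xz : X × K => (q xz.1).eval xz.2 := by
  simp only [eval_eq_sum_range, natDegree_eq_of_degree_eq_some (hdeg _)]
  exact continuous_finsetSum _ fun k _ =>
    ((hcoeff k).comp continuous_fst).mul (continuous_snd.pow k)

theorem continuous_cauchyBound_of_continuous_coeff :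
    Continuous fun x => (q x).cauchyBound := by
  have hlead (x : X) : ‖(q x).coeff m‖₊ ≠ 0 := by
    simpa using coeff_ne_zero_of_eq_degree (hdeg x)
  simp only [cauchyBound, leadingCoeff, natDegree_eq_of_degree_eq_some (hdeg _)]
  exact ((Continuous.finset_sup_apply fun k _ => (hcoeff k).nnnorm).div₀ (hcoeff m).nnnorm
    hlead).add continuous_const

theorem isOpen_setOf_exists_isRoot_mem [IsAlgClosed K] {U : Set K} (hU : IsOpen U) :
    IsOpen {x | ∃ w ∈ U, (q x).IsRoot w} := by
  rw [isOpen_iff_mem_nhds]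
  rintro x ⟨w, hwU, hw⟩
  obtain ⟨ε, hε, hball⟩ := Metric.isOpen_iff.1 hU w hwU
  have hsmall : ∀ᶠ y in 𝓝 x, ‖(q y).eval w‖ < ‖(q y).coeff m‖ * ε ^ m := by
    have heval : Continuous fun y => (q y).eval w :=
      (continuous_eval_of_continuous_coeff hcoeff hdeg).comp (.prodMk_left w)
    refine heval.norm.continuousAt.eventually_lt
      ((hcoeff m).norm.mul continuous_const).continuousAt ?_
    rw [hw.eq_zero, norm_zero]
    exact mul_pos (norm_pos_iff.2 (coeff_ne_zero_of_eq_degree (hdeg x))) (pow_pos hε m)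
  filter_upwards [hsmall] with y hy
  by_contra! hno
  have hlarge := norm_leadingCoeff_mul_pow_le_norm_eval (IsAlgClosed.splits (q y)) hε.le
    fun v hv => not_lt.1 fun hwv => hno v (hball (by rwa [mem_ball_iff_norm'])) hv
  rw [leadingCoeff, natDegree_eq_of_degree_eq_some (hdeg y)] at hlarge
  exact hy.not_ge hlarge

theorem isClosed_setOf_exists_isRoot_mem [ProperSpace K] {F : Set K} (hF : IsClosed F) :
    IsClosed {x | ∃ w ∈ F, (q x).IsRoot w} := by
  rw [← isOpen_compl_iff, isOpen_iff_mem_nhds]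
  intro x hx
  let B := (q x).cauchyBound + 1
  have hbound : ∀ᶠ y in 𝓝 x, (q y).cauchyBound < B :=
    (continuous_cauchyBound_of_continuous_coeff hcoeff hdeg).continuousAt.eventually_lt_const
      (lt_add_one _)
  have hcompact : ∀ᶠ y in 𝓝 x, ∀ w ∈ F ∩ Metric.closedBall 0 B, (q y).eval w ≠ 0 := by
    refine ((isCompact_closedBall _ _).inter_left hF).eventually_forall_of_forall_eventually
      fun w hw => ?_
    exact (continuous_eval_of_continuous_coeff hcoeff hdeg).continuousAt.eventually_ne
      fun hxw => hx ⟨w, hw.1, hxw⟩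
  filter_upwards [hbound, hcompact] with y hyB hy
  rintro ⟨w, hwF, hw⟩
  have hy0 : q y ≠ 0 := fun h => by simpa [h] using hdeg y
  refine hy w ⟨hwF, mem_closedBall_zero_iff.2 ?_⟩ hw
  exact_mod_cast ((hw.norm_lt_cauchyBound hy0).trans hyB).le

theorem not_isRoot_of_forall_frontier_not_isRoot [IsAlgClosed K] [ProperSpace K]
    [PreconnectedSpace X] {U : Set K} (hU : IsOpen U)
    (hfrontier : ∀ x, ∀ w ∈ frontier U, ¬ (q x).IsRoot w) {x₀ : X}
    (h₀ : ∀ w ∈ U, ¬ (q x₀).IsRoot w) (x : X) {w : K} (hw : w ∈ U) : ¬ (q x).IsRoot w := by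
  have hclosure : {x | ∃ w ∈ U, (q x).IsRoot w} = {x | ∃ w ∈ closure U, (q x).IsRoot w} := by
    ext x
    refine ⟨fun ⟨w, hwU, hw⟩ => ⟨w, subset_closure hwU, hw⟩, fun ⟨w, hwU, hw⟩ => ⟨w, ?_, hw⟩⟩
    by_contra hwU'
    exact hfrontier x w ⟨hwU, by rwa [hU.interior_eq]⟩ hw
  have hclopen : IsClopen {x | ∃ w ∈ U, (q x).IsRoot w} :=
    ⟨hclosure ▸ isClosed_setOf_exists_isRoot_mem hcoeff hdeg isClosed_closure,
      isOpen_setOf_exists_isRoot_mem hcoeff hdeg hU⟩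
  rcases isClopen_iff.1 hclopen with hempty | huniv
  · exact fun hroot => hempty.subset ⟨w, hw, hroot⟩
  · obtain ⟨w₀, hw₀, hroot⟩ := huniv.ge (Set.mem_univ x₀)
    exact absurd hroot (h₀ w₀ hw₀)

end RootFamilies

section LineRestriction

open MvPolynomial

variable {R A σ : Type*} [CommSemiring R]

/-- The top-degree homogeneous part of `p`. -/
noncomputable def leadingForm (p : MvPolynomial σ R) : MvPolynomial σ R :=
  homogeneousComponent p.totalDegree p

theorem isHomogeneous_leadingForm (p : MvPolynomial σ R) :
    (leadingForm p).IsHomogeneous p.totalDegree :=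
  homogeneousComponent_isHomogeneous _ p

theorem leadingForm_eq_self_of_isHomogeneous {p : MvPolynomial σ R} {m : ℕ}
    (hp : p.IsHomogeneous m) : leadingForm p = p := by
  rcases eq_or_ne p 0 with rfl | hp0
  · exact map_zero _
  · rw [leadingForm, hp.totalDegree hp0]
    exact homogeneousComponent_of_mem hp |>.trans (if_pos rfl)

theorem leadingForm_ne_zero {p : MvPolynomial σ R} (hp : p ≠ 0) : leadingForm p ≠ 0 := by
  obtain ⟨d, hd, hdeg⟩ := Finset.exists_mem_eq_sup p.support (support_nonempty.2 hp)
    fun d => d.sum fun _ k => k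
  refine ne_zero_iff.2 ⟨d, ?_⟩
  have hd' : d.degree = p.totalDegree := hdeg.symm
  rw [leadingForm, coeff_homogeneousComponent, if_pos hd']
  exact mem_support_iff.1 hd

variable [CommSemiring A] [Algebra R A]

theorem aeval_smul_of_isHomogeneous {F : MvPolynomial σ R} {m : ℕ} (hF : F.IsHomogeneous m)
    (a : A) (x : σ → A) : aeval (a • x) F = a ^ m * aeval x F := by
  rw [aeval_def, aeval_def, eval₂_eq, eval₂_eq, Finset.mul_sum]
  refine Finset.sum_congr rfl fun d hd => ?_
  rw [hF.degree_eq_sum_deg_support hd]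
  simp only [Pi.smul_apply, smul_eq_mul, mul_pow, Finset.prod_mul_distrib,
    Finset.prod_pow_eq_pow_sum]
  ring

/-- The univariate polynomial `t ↦ p(x + t v)`: the restriction of `p` to the line through `x` in
direction `v`. -/
noncomputable def lineRestriction (p : MvPolynomial σ R) (x v : σ → A) : Polynomial A :=
  aeval (fun i => Polynomial.C (x i) + Polynomial.C (v i) * Polynomial.X) p

theorem aeval_lineRestriction {B : Type*} [CommSemiring B] [Algebra R B] [Algebra A B]
    [IsScalarTower R A B] (p : MvPolynomial σ R) (x v : σ → A) (b : B) :
    Polynomial.aeval b (lineRestriction p x v) =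
      aeval (fun i => algebraMap A B (x i) + algebraMap A B (v i) * b) p := by
  have hcomp := comp_aeval_apply (fun i => Polynomial.C (x i) + Polynomial.C (v i) * Polynomial.X)
    ((Polynomial.aeval b).restrictScalars R) p
  simpa [lineRestriction] using hcomp

theorem eval_lineRestriction (p : MvPolynomial σ R) (x v : σ → A) (a : A) :
    (lineRestriction p x v).eval a = aeval (x + a • v) p := by
  rw [← Polynomial.coe_aeval_eq_eval, aeval_lineRestriction]
  congr
  ext i
  simp [mul_comm]

theorem lineRestriction_add_smul (p : MvPolynomial σ R) (x v : σ → A) (a : A) :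
    lineRestriction p (x + a • v) v = (lineRestriction p x v).comp (.X + .C a) := by
  rw [Polynomial.comp_eq_aeval, aeval_lineRestriction, lineRestriction]
  congr
  ext1 i
  simp only [Pi.add_apply, Pi.smul_apply, smul_eq_mul, map_add, map_mul,
    Polynomial.algebraMap_eq]
  ring

theorem lineRestriction_X (i : σ) (x v : σ → A) :
    lineRestriction (X i : MvPolynomial σ R) x v =
      Polynomial.C (x i) + Polynomial.C (v i) * Polynomial.X :=
  aeval_X _ i

theorem lineRestriction_mul (p q : MvPolynomial σ R) (x v : σ → A) :
    lineRestriction (p * q) x v = lineRestriction p x v * lineRestriction q x v :=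
  map_mul _ p q

theorem lineRestriction_eq_sum_monomial (p : MvPolynomial σ R) (x v : σ → A) :
    lineRestriction p x v = ∑ d ∈ p.support, lineRestriction (monomial d (p.coeff d)) x v := by
  conv_lhs => rw [p.as_sum, lineRestriction, map_sum]
  rfl

theorem natDegree_lineRestriction_monomial_le (d : σ →₀ ℕ) (c : R) (x v : σ → A) :
    (lineRestriction (monomial d c) x v).natDegree ≤ d.degree := by
  rw [lineRestriction, aeval_monomial]
  refine (Polynomial.natDegree_C_mul_le _ _).trans ((Polynomial.natDegree_prod_le _ _).trans ?_)
  refine Finset.sum_le_sum fun i _ => ?_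
  have hlin : (Polynomial.C (x i) + Polynomial.C (v i) * Polynomial.X).natDegree ≤ 1 := by
    compute_degree
  simpa only [mul_one] using Polynomial.natDegree_pow_le_of_le (d i) hlin

theorem coeff_lineRestriction_monomial (d : σ →₀ ℕ) (c : R) (x v : σ → A) :
    (lineRestriction (monomial d c) x v).coeff d.degree = aeval v (monomial d c) := by
  induction d using Finsupp.induction_linear generalizing c with
  | zero => simp [lineRestriction]
  | add d e hd he =>
    rw [← mul_one c, ← monomial_mul, lineRestriction_mul, map_mul, map_add,
      Polynomial.coeff_mul_add_eq_of_natDegree_le (natDegree_lineRestriction_monomial_le d _ x v)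
        (natDegree_lineRestriction_monomial_le e _ x v), hd, he]
  | single i k =>
    have hlin : (Polynomial.C (x i) + Polynomial.C (v i) * Polynomial.X).natDegree ≤ 1 := by
      compute_degree
    have hpow := Polynomial.coeff_pow_of_natDegree_le (m := k) hlin
    rw [mul_one] at hpow
    simp [lineRestriction, aeval_monomial, hpow, Polynomial.coeff_C]

theorem natDegree_lineRestriction_le (p : MvPolynomial σ R) (x v : σ → A) :
    (lineRestriction p x v).natDegree ≤ p.totalDegree := by
  rw [lineRestriction_eq_sum_monomial]
  exact Polynomial.natDegree_sum_le_of_forall_le _ _ fun d hd =>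
    (natDegree_lineRestriction_monomial_le d _ x v).trans (le_totalDegree hd)

theorem coeff_totalDegree_lineRestriction (p : MvPolynomial σ R) (x v : σ → A) :
    (lineRestriction p x v).coeff p.totalDegree = aeval v (leadingForm p) := by
  rw [lineRestriction_eq_sum_monomial, Polynomial.finsetSum_coeff, leadingForm,
    homogeneousComponent_apply, map_sum, Finset.sum_filter]
  refine Finset.sum_congr rfl fun d hd => ?_
  split_ifs with h
  · rw [← h, coeff_lineRestriction_monomial]
  · exact Polynomial.coeff_eq_zero_of_natDegree_lt <|
      (natDegree_lineRestriction_monomial_le d _ x v).trans_lt <|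
        lt_of_le_of_ne (le_totalDegree hd) h

theorem degree_lineRestriction {p : MvPolynomial σ R} (x : σ → A) {v : σ → A}
    (hv : aeval v (leadingForm p) ≠ 0) :
    (lineRestriction p x v).degree = p.totalDegree :=
  Polynomial.degree_eq_of_le_of_coeff_ne_zero
    (Polynomial.degree_le_of_natDegree_le (natDegree_lineRestriction_le p x v))
    (by rwa [coeff_totalDegree_lineRestriction])

theorem continuous_coeff_lineRestriction [TopologicalSpace A] [IsTopologicalSemiring A]
    {X : Type*} [TopologicalSpace X] (p : MvPolynomial σ R) {x v : X → σ → A}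
    (hx : Continuous x) (hv : Continuous v) (k : ℕ) :
    Continuous fun s => (lineRestriction p (x s) (v s)).coeff k := by
  induction p using MvPolynomial.induction_on generalizing k with
  | C r => simpa [lineRestriction] using continuous_const
  | add p q hp hq =>
    simp only [lineRestriction, map_add, Polynomial.coeff_add]
    exact (hp k).add (hq k)
  | mul_X p i hp =>
    have hxi : Continuous fun s => x s i := (continuous_apply i).comp hx
    have hvi : Continuous fun s => v s i := (continuous_apply i).comp hv
    simp only [lineRestriction_mul, lineRestriction_X, mul_add, ← mul_assoc, Polynomial.coeff_add,
      Polynomial.coeff_mul_C]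
    cases k with
    | zero =>
      simp only [Polynomial.coeff_mul_X_zero, add_zero]
      exact (hp 0).mul hxi
    | succ k =>
      simp only [Polynomial.coeff_mul_X, Polynomial.coeff_mul_C]
      exact ((hp (k + 1)).mul hxi).add ((hp k).mul hvi)

/-- The homogenization `t ^ m * p(x / t)` of `p`, where `m` is the total degree of `p` and `none` is
the index of the homogenizing variable `t`. -/
noncomputable def optionHomogenization (p : MvPolynomial σ R) : MvPolynomial (Option σ) R :=
  ∑ k ∈ Finset.range (p.totalDegree + 1),
    rename some (homogeneousComponent k p) * X none ^ (p.totalDegree - k)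

theorem isHomogeneous_optionHomogenization (p : MvPolynomial σ R) :
    (optionHomogenization p).IsHomogeneous p.totalDegree := by
  refine IsHomogeneous.sum _ _ _ fun k hk => ?_
  have hle : k ≤ p.totalDegree := Nat.lt_succ_iff.1 (Finset.mem_range.1 hk)
  have := (homogeneousComponent_isHomogeneous k p).rename_isHomogeneous (f := some) |>.mul
    (isHomogeneous_X_pow (R := R) (none : Option σ) (p.totalDegree - k))
  rwa [Nat.add_sub_cancel' hle] at this

theorem aeval_optionHomogenization (p : MvPolynomial σ R) (a : A) (x : σ → A) :
    aeval (fun i => Option.elim i a x) (optionHomogenization p) =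
      ∑ k ∈ Finset.range (p.totalDegree + 1),
        aeval x (homogeneousComponent k p) * a ^ (p.totalDegree - k) := by
  simp [optionHomogenization, aeval_rename, Function.comp_def]

theorem aeval_zero_optionHomogenization (p : MvPolynomial σ R) (x : σ → A) :
    aeval (fun i => Option.elim i 0 x) (optionHomogenization p) = aeval x (leadingForm p) := by
  rw [aeval_optionHomogenization, Finset.sum_range_succ, Finset.sum_eq_zero fun k hk => ?_]
  · simp [leadingForm]
  · rw [zero_pow (Nat.sub_pos_of_lt (Finset.mem_range.1 hk)).ne', mul_zero]

theorem aeval_smul_optionHomogenization (p : MvPolynomial σ R) (a : A) (x : σ → A) :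
    aeval (fun i => Option.elim i a (a • x)) (optionHomogenization p) =
      a ^ p.totalDegree * aeval x p := by
  have hsum : aeval x p =
      ∑ k ∈ Finset.range (p.totalDegree + 1), aeval x (homogeneousComponent k p) := by
    rw [← map_sum, sum_homogeneousComponent]
  rw [aeval_optionHomogenization, hsum, Finset.mul_sum]
  refine Finset.sum_congr rfl fun k hk => ?_
  have hle : k ≤ p.totalDegree := Nat.lt_succ_iff.1 (Finset.mem_range.1 hk)
  rw [aeval_smul_of_isHomogeneous (homogeneousComponent_isHomogeneous k p), mul_right_comm,
    ← pow_add, Nat.add_sub_cancel' hle]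

theorem isOpen_setOf_exists_aeval_optionHomogenization_eq_zero {K : Type*} [NormedField K]
    [IsAlgClosed K] [Algebra R K] (p : MvPolynomial σ R) (x : σ → K) {c : σ → K}
    (hc : aeval c (leadingForm p) ≠ 0) {U : Set K} (hU : IsOpen U) :
    IsOpen {τ : K | ∃ w ∈ U,
      aeval (fun i => Option.elim i τ (x + w • c)) (optionHomogenization p) = 0} := by
  let q (τ : K) : Polynomial K := lineRestriction (optionHomogenization p)
    (fun i => i.elim τ x) (fun i => i.elim 0 c)
  have hroot (τ w : K) : (q τ).IsRoot w ↔
      aeval (fun i => Option.elim i τ (x + w • c)) (optionHomogenization p) = 0 := by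
    rw [Polynomial.IsRoot, eval_lineRestriction]
    congr! 2
    ext (_ | j) <;> simp
  have hdeg (τ : K) : (q τ).degree = (optionHomogenization p).totalDegree :=
    degree_lineRestriction _ <| by
      rwa [leadingForm_eq_self_of_isHomogeneous (isHomogeneous_optionHomogenization p),
        aeval_zero_optionHomogenization]
  have hcoeff (k : ℕ) : Continuous fun τ => (q τ).coeff k := by
    refine continuous_coeff_lineRestriction _ (continuous_pi ?_) continuous_const k
    rintro (_ | j)
    · exact continuous_id
    · exact continuous_const
  simpa only [hroot] using isOpen_setOf_exists_isRoot_mem hcoeff hdeg hU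

end LineRestriction

section RealStability

open MvPolynomial Topology

theorem RealRooted.comp_X_add_C {f : Polynomial ℝ} (hf : RealRooted f) (s : ℝ) :
    RealRooted (f.comp (.X + .C s)) := by
  rcases hf with rfl | hf
  · exact Or.inl Polynomial.zero_comp
  · refine Or.inr fun z hz => ?_
    have hroot := hf (z + s) (by simpa [Polynomial.aeval_comp] using hz)
    simpa using hroot

theorem realRooted_of_forall_im_pos {f : Polynomial ℝ}
    (hf : ∀ z : ℂ, 0 < z.im → Polynomial.aeval z f ≠ 0) : RealRooted f := by
  refine Or.inr fun z hz => le_antisymm (not_lt.1 fun him => hf z him hz) (not_lt.1 fun him => ?_)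
  refine hf (starRingEnd ℂ z) (by simpa using him) ?_
  rw [Polynomial.aeval_conj, hz, map_zero]

variable {σ : Type*} {p : MvPolynomial σ ℝ}

theorem RealStable.realRooted_lineRestriction (hp : RealStable p) (x : σ → ℝ) {v : σ → ℝ}
    (hv : ∀ i, 0 < v i) : RealRooted (lineRestriction p x v) := by
  rcases hp with rfl | hp
  · exact Or.inl (map_zero _)
  · refine realRooted_of_forall_im_pos fun z hz => ?_
    rw [aeval_lineRestriction]
    exact hp _ fun i => by simpa using mul_pos (hv i) hz

theorem RealStable.aeval_optionHomogenization_ne_zero (hp : RealStable p) (hp0 : p ≠ 0) {τ : ℝ}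
    (hτ : 0 < τ) {z : σ → ℂ} (hz : ∀ i, 0 < (z i).im) :
    aeval (fun i => Option.elim i (τ : ℂ) z) (optionHomogenization p) ≠ 0 := by
  have hτ0 : (τ : ℂ) ≠ 0 := Complex.ofReal_ne_zero.2 hτ.ne'
  rw [← smul_inv_smul₀ hτ0 z, aeval_smul_optionHomogenization]
  refine mul_ne_zero (pow_ne_zero _ hτ0) (hp.resolve_left hp0 _ fun i => ?_)
  rw [Pi.smul_apply, smul_eq_mul, ← Complex.ofReal_inv, Complex.im_ofReal_mul]
  exact mul_pos (inv_pos.2 hτ) (hz i)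

theorem aeval_ofReal_comp (p : MvPolynomial σ ℝ) (x : σ → ℝ) :
    aeval (Complex.ofReal ∘ x) p = (eval x p : ℂ) := by
  simpa [Function.comp_def] using aeval_algebraMap_apply ℂ x p

theorem exists_eval_leadingForm_ne_zero (hp : p ≠ 0) : ∃ c, eval c (leadingForm p) ≠ 0 := by
  by_contra! h
  exact leadingForm_ne_zero hp (MvPolynomial.funext fun c => by rw [h c, map_zero])

theorem RealStable.eval_leadingForm_ne_zero [Finite σ] (hp : RealStable p) (hp0 : p ≠ 0)
    {v : σ → ℝ} (hv : ∀ i, 0 < v i) : eval v (leadingForm p) ≠ 0 := by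
  intro hLv
  obtain ⟨c, hc⟩ := exists_eval_leadingForm_ne_zero hp0
  let x : σ → ℂ := Complex.I • Complex.ofReal ∘ v
  let y : σ → ℂ := Complex.ofReal ∘ c
  let U : Set ℂ := {w | ∀ i, 0 < ((x + w • y) i).im}
  have hU : IsOpen U := by
    simp only [U, Set.ofPred_forall]
    exact isOpen_iInter_of_finite fun i => isOpen_lt continuous_const (by fun_prop)
  have hy : aeval y (leadingForm p) ≠ 0 := by
    rw [aeval_ofReal_comp]
    exact_mod_cast hc
  have hx : aeval x (leadingForm p) = 0 := by
    rw [aeval_smul_of_isHomogeneous (isHomogeneous_leadingForm p), aeval_ofReal_comp, hLv,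
      Complex.ofReal_zero, mul_zero]
  have hzero : ∀ᶠ τ : ℂ in 𝓝 0, ∃ w ∈ U,
      aeval (fun i => Option.elim i τ (x + w • y)) (optionHomogenization p) = 0 := by
    refine (isOpen_setOf_exists_aeval_optionHomogenization_eq_zero p x hy hU).mem_nhds
      ⟨0, fun i => by simpa [x] using hv i, ?_⟩
    rwa [zero_smul, add_zero, aeval_zero_optionHomogenization]
  have hzero_real : ∀ᶠ τ : ℝ in 𝓝[>] 0, ∃ w ∈ U,
      aeval (fun i => Option.elim i (τ : ℂ) (x + w • y)) (optionHomogenization p) = 0 :=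
    ((Complex.continuous_ofReal.tendsto' 0 0 Complex.ofReal_zero).eventually hzero).filter_mono
      nhdsWithin_le_nhds
  obtain ⟨τ, ⟨w, hw, hroot⟩, hτ⟩ := (hzero_real.and self_mem_nhdsWithin).exists
  exact hp.aeval_optionHomogenization_ne_zero hp0 hτ hw hroot

theorem RealStable.leadingForm_pos_or_neg [Finite σ] (hp : RealStable p) (hp0 : p ≠ 0) :
    (∀ v : σ → ℝ, (∀ i, 0 < v i) → 0 < eval v (leadingForm p)) ∨
      (∀ v : σ → ℝ, (∀ i, 0 < v i) → eval v (leadingForm p) < 0) := by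
  have horthant : IsPreconnected (Set.univ.pi fun _ : σ => Set.Ioi (0 : ℝ)) :=
    isPreconnected_univ_pi fun _ => isPreconnected_Ioi
  by_contra! ⟨⟨v, hv, hLv⟩, ⟨w, hw, hLw⟩⟩
  obtain ⟨u, hu, hLu⟩ := horthant.intermediate_value (fun i _ => hv i) (fun i _ => hw i)
    (continuous_eval (leadingForm p)).continuousOn ⟨hLv, hLw⟩
  exact hp.eval_leadingForm_ne_zero hp0 (fun i => hu i trivial) hLu

section Converse

variable {e : σ → ℝ}

theorem aeval_add_smul_ne_zero_of_realRooted (he : eval e (leadingForm p) ≠ 0)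
    {x : σ → ℝ} (hroots : RealRooted (lineRestriction p x e)) {ζ : ℂ} (hζ : ζ.im ≠ 0) :
    aeval (Complex.ofReal ∘ x + ζ • Complex.ofReal ∘ e) p ≠ 0 := by
  have hne : lineRestriction p x e ≠ 0 := fun h => by
    have hdeg := degree_lineRestriction (p := p) x (v := e) he
    rw [h, Polynomial.degree_zero] at hdeg
    exact WithBot.bot_ne_natCast _ hdeg
  have hroot := mt (hroots.resolve_left hne ζ) hζ
  rw [aeval_lineRestriction] at hroot
  convert hroot using 3
  ext i
  simp [mul_comm]

theorem aeval_ne_zero_of_forall_realRooted (hepos : ∀ i, 0 < e i)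
    (hroots : ∀ x, RealRooted (lineRestriction p x e))
    (hlead : ∀ v : σ → ℝ, (∀ i, 0 < v i) → eval v (leadingForm p) ≠ 0)
    (x : σ → ℝ) {α : ℝ} (hα : 0 < α) {v : σ → ℝ} (hv : ∀ i, 0 < v i) {w : ℂ} (hw : 0 < w.im) :
    aeval (Complex.ofReal ∘ x + (α * Complex.I) • Complex.ofReal ∘ e + w • Complex.ofReal ∘ v) p
      ≠ 0 := by
  let orthant : Set (σ → ℝ) := Set.univ.pi fun _ => Set.Ioi 0
  have : PreconnectedSpace orthant :=
    isPreconnected_iff_preconnectedSpace.1 (isPreconnected_univ_pi fun _ => isPreconnected_Ioi)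
  let q (u : orthant) : Polynomial ℂ := lineRestriction p
    (Complex.ofReal ∘ x + (α * Complex.I) • Complex.ofReal ∘ e) (Complex.ofReal ∘ u)
  have hdeg (u : orthant) : (q u).degree = p.totalDegree := degree_lineRestriction _ <| by
    rw [aeval_ofReal_comp]
    exact_mod_cast hlead u fun i => u.2 i trivial
  have hcoeff (k : ℕ) : Continuous fun u => (q u).coeff k :=
    continuous_coeff_lineRestriction p continuous_const
      (continuous_pi fun i => Complex.continuous_ofReal.comp <|
        (continuous_apply i).comp continuous_subtype_val) k
  have hlead_e : eval e (leadingForm p) ≠ 0 := hlead e hepos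
  have hαI : (α * Complex.I).im ≠ 0 := by simpa using hα.ne'
  have hfrontier (u : orthant) (s : ℂ) (hs : s ∈ frontier {s : ℂ | 0 < s.im}) :
      ¬ (q u).IsRoot s := by
    have hs_real : ((s.re : ℝ) : ℂ) = s := by
      rw [Complex.frontier_setOfPred_lt_im] at hs
      exact Complex.ext rfl hs.symm
    rw [Polynomial.IsRoot, eval_lineRestriction]
    convert aeval_add_smul_ne_zero_of_realRooted hlead_e (hroots (x + s.re • u)) hαI using 3
    ext i
    simp only [aeval_X, Pi.add_apply, Function.comp_apply, Pi.smul_apply, smul_eq_mul,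
      Complex.ofReal_add, Complex.ofReal_mul, hs_real]
    ring
  have hbase (s : ℂ) (hs : 0 < s.im) : ¬ (q ⟨e, fun i _ => hepos i⟩).IsRoot s := by
    have hαs : (α * Complex.I + s).im ≠ 0 := by simpa using (add_pos hα hs).ne'
    rw [Polynomial.IsRoot, eval_lineRestriction, add_assoc, ← add_smul]
    exact aeval_add_smul_ne_zero_of_realRooted hlead_e (hroots x) hαs
  have := not_isRoot_of_forall_frontier_not_isRoot hcoeff hdeg
    (isOpen_lt continuous_const Complex.continuous_im) hfrontier hbase ⟨v, fun i _ => hv i⟩ hw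
  rwa [Polynomial.IsRoot, eval_lineRestriction] at this

theorem realStable_of_forall_realRooted [Finite σ] (hepos : ∀ i, 0 < e i)
    (hroots : ∀ x, RealRooted (lineRestriction p x e))
    (hlead : ∀ v : σ → ℝ, (∀ i, 0 < v i) → eval v (leadingForm p) ≠ 0) : RealStable p := by
  refine Or.inr fun z hz => ?_
  have hsmall : ∀ᶠ α : ℝ in 𝓝[>] 0, ∀ i, α * e i < (z i).im := by
    refine Filter.eventually_all.2 fun i => Filter.Eventually.filter_mono nhdsWithin_le_nhds ?_
    exact ((continuous_mul_const (e i)).tendsto' 0 0 (zero_mul _)).eventually_lt_const (hz i)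
  obtain ⟨α, hαz, hα⟩ := (hsmall.and self_mem_nhdsWithin).exists
  have := aeval_ne_zero_of_forall_realRooted hepos hroots hlead (fun i => (z i).re) hα
    (v := fun i => (z i).im - α * e i) (fun i => sub_pos.2 (hαz i)) (w := Complex.I) (by simp)
  convert this using 3
  ext i
  apply Complex.ext <;> simp

end Converse

theorem mainTheorem2_general [Finite σ] (hp : p ≠ 0) {e : σ → ℝ} (he : ∀ i, 0 < e i) :
    RealStable p ↔
      (∀ x, RealRooted (lineRestriction p x e)) ∧
      ((∀ v : σ → ℝ, (∀ i, 0 < v i) → 0 < eval v (leadingForm p)) ∨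
        (∀ v : σ → ℝ, (∀ i, 0 < v i) → eval v (leadingForm p) < 0)) := by
  refine ⟨fun h => ⟨fun x => h.realRooted_lineRestriction x he, h.leadingForm_pos_or_neg hp⟩,
    fun ⟨hroots, hsign⟩ => realStable_of_forall_realRooted he hroots fun v hv => ?_⟩
  rcases hsign with hpos | hneg
  · exact (hpos v hv).ne'
  · exact (hneg v hv).ne

end RealStability

section Bivariate

open MvPolynomial

theorem diagRestriction_eq_lineRestriction (p : MvPolynomial (Fin 2) ℝ) (γ : ℝ) :
    diagRestriction p γ = lineRestriction p ![γ, 0] 1 := by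
  rw [diagRestriction, lineRestriction]
  congr
  ext1 i
  fin_cases i <;> simp

theorem forall_realRooted_diagRestriction_iff (p : MvPolynomial (Fin 2) ℝ) :
    (∀ γ, RealRooted (diagRestriction p γ)) ↔ ∀ x, RealRooted (lineRestriction p x 1) := by
  simp only [diagRestriction_eq_lineRestriction]
  refine ⟨fun h x => ?_, fun h γ => h _⟩
  have hx : x = ![x 0 - x 1, 0] + x 1 • 1 := by
    ext i
    fin_cases i <;> simp
  rw [hx, lineRestriction_add_smul]
  exact (h _).comp_X_add_C _

theorem eval_homogenization_zero (p : MvPolynomial (Fin 2) ℝ) (x y : ℝ) :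
    eval ![x, y, 0] (homogenization p) = eval ![x, y] (leadingForm p) := by
  rw [homogenization, leadingForm, homogeneousComponent_apply, map_sum, map_sum, Finset.sum_filter]
  refine Finset.sum_congr rfl fun d hd => ?_
  have hdeg : d.degree = d 0 + d 1 := by
    rw [Finsupp.degree_eq_sum, Fin.sum_univ_two]
  have hle : d.degree ≤ p.totalDegree := le_totalDegree hd
  split_ifs with h
  · simp [← hdeg, h, eval_monomial, Finsupp.prod_fintype, mul_assoc]
  · have hpow : p.totalDegree - d.degree ≠ 0 := (Nat.sub_pos_of_lt (hle.lt_of_ne h)).ne'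
    simp [← hdeg, hpow]

theorem forall_pos_iff_forall_mem_Ioo {P : (Fin 2 → ℝ) → Prop}
    (hP : ∀ s : ℝ, 0 < s → ∀ v, P (s • v) ↔ P v) :
    (∀ v : Fin 2 → ℝ, (∀ i, 0 < v i) → P v) ↔ ∀ t ∈ Set.Ioo (0 : ℝ) 1, P ![t, 1 - t] := by
  refine ⟨fun h t ht => h _ (Fin.forall_fin_two.2 ⟨ht.1, sub_pos.2 ht.2⟩), fun h v hv => ?_⟩
  have hs : 0 < v 0 + v 1 := add_pos (hv 0) (hv 1)
  have hv_eq : v = (v 0 + v 1) • ![v 0 / (v 0 + v 1), 1 - v 0 / (v 0 + v 1)] := by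
    ext i
    fin_cases i <;> simp [mul_sub, mul_div_cancel₀, hs.ne']
  rw [hv_eq, hP _ hs]
  exact h _ ⟨div_pos (hv 0) hs, (div_lt_one hs).2 (lt_add_of_pos_right _ (hv 1))⟩

theorem eval_smul_leadingForm {σ : Type*} (p : MvPolynomial σ ℝ) (s : ℝ) (v : σ → ℝ) :
    eval (s • v) (leadingForm p) = s ^ p.totalDegree * eval v (leadingForm p) :=
  aeval_smul_of_isHomogeneous (isHomogeneous_leadingForm p) s v

theorem forall_leadingForm_pos_iff (p : MvPolynomial (Fin 2) ℝ) :
    (∀ v : Fin 2 → ℝ, (∀ i, 0 < v i) → 0 < eval v (leadingForm p)) ↔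
      ∀ t ∈ Set.Ioo (0 : ℝ) 1, 0 < eval ![t, 1 - t, 0] (homogenization p) := by
  simp only [eval_homogenization_zero]
  refine forall_pos_iff_forall_mem_Ioo fun s hs v => ?_
  rw [eval_smul_leadingForm, ← smul_eq_mul, smul_pos_iff_of_pos_left (pow_pos hs _)]

theorem forall_leadingForm_neg_iff (p : MvPolynomial (Fin 2) ℝ) :
    (∀ v : Fin 2 → ℝ, (∀ i, 0 < v i) → eval v (leadingForm p) < 0) ↔
      ∀ t ∈ Set.Ioo (0 : ℝ) 1, eval ![t, 1 - t, 0] (homogenization p) < 0 := by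
  simp only [eval_homogenization_zero]
  refine forall_pos_iff_forall_mem_Ioo fun s hs v => ?_
  rw [eval_smul_leadingForm, ← smul_eq_mul, smul_neg_iff_of_pos_left (pow_pos hs _)]

end Bivariate

theorem mainTheorem2 (n : ℕ) (p : MvPolynomial (Fin 2) ℝ)
    (hpn : p ∈ MvPolynomial.restrictDegree (Fin 2) ℝ n) (hp : p ≠ 0) :
    RealStable p ↔
      (∀ γ : ℝ, RealRooted (diagRestriction p γ)) ∧
      ((∀ t ∈ Set.Ioo (0 : ℝ) 1, 0 < MvPolynomial.eval ![t, 1 - t, 0] (homogenization p)) ∨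
        (∀ t ∈ Set.Ioo (0 : ℝ) 1, MvPolynomial.eval ![t, 1 - t, 0] (homogenization p) < 0)) := by
  rw [forall_realRooted_diagRestriction_iff, ← forall_leadingForm_pos_iff,
    ← forall_leadingForm_neg_iff]
  exact mainTheorem2_general hp fun _ => one_pos
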